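/- For a group $G$, let $\mathrm{Q}(G)$ be the real vector space of homogeneous quasimorphisms on $G$, that is, of functions $\varphi\colon G\to\mathbb{R}$ with finite defect $D(\varphi)=\sup_{g,h\in G}|\varphi(g)+\varphi(h)-\varphi(gh)|$ and $\varphi(g^n)=n\varphi(g)$ for all $g\in G$, $n\in\mathbb{Z}$, and let $\mathrm{Hom}(G)\subseteq\mathrm{Q}(G)$ be the subspace of homomorphisms $G\to\mathbb{R}$. Let $\mathrm{C}_1(G)$ be the real vector space with basis $G$ and $\mathrm{B}_1(G)$ its subspace of boundaries, spanned by the chains $g+h-gh$ with $g,h\in G$. For $g_1,\dots,g_m\in G$, let $\mathrm{cl}_G(\sum_i g_i)\in\mathbb{N}\cup\{\infty\}$ be the least number of commutators whose product is equal to an expression $\prod_i t_ig_it_i^{-1}$ with $t_i\in G$ ($\infty$ if there is none), and let $\mathrm{scl}_G(\sum_i g_i)=\lim_{n}\mathrm{cl}_G(\sum_i g_i^n)/n$, where $n$ ranges over the positive integers such that $\mathrm{cl}_G(\sum_i g_i^n)<\infty$ (and $\mathrm{scl}_G(\sum_i g_i)=\infty$ if there are none). Representing $-g$ by $g^{-1}$,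 this extends to rational chains by homogeneity, and then to all of $\mathrm{B}_1(G)$ by continuity (on finite-dimensional subspaces); put $\mathrm{scl}_G=\infty$ on $\mathrm{C}_1(G)\setminus\mathrm{B}_1(G)$. Let $\mathrm{C}_1^H(G)$ be the quotient of $\mathrm{C}_1(G)$ by the subspace spanned by all $g^n-ng$ and $hgh^{-1}-g$ with $g,h\in G$, $n\in\mathbb{Z}$; $\mathrm{scl}_G$ descends to $\mathrm{C}_1^H(G)$. A group homomorphism $G_1\to G_2$ is called isometric for $\mathrm{scl}$ if the induced map $\mathrm{C}_1^H(G_1)\to\mathrm{C}_1^H(G_2)$ preserves $\mathrm{scl}$ (including the value $\infty$). **Statement.** Let $f\colon G_1\to G_2$ be a group homomorphism that is isometric for $\mathrm{scl}$. Then for every $\varphi_1\in\mathrm{Q}(G_1)$ there exists $\varphi_2\in\mathrm{Q}(G_2)$ with $D(\varphi_2)=D(\varphi_1)$ and $\varphi_2\circ f=\varphi_1$. In particular, the pullback $\varphi\mapsto\varphi\circ f$ induces a surjection $\mathrm{Q}(G_2)/\mathrm{Hom}(G_2)\to\mathrm{Q}(G_1)/\mathrm{Hom}(G_1)$. -/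

import Mathlib

open Filter Topology
open scoped ENNReal

noncomputable section

namespace Scl

/-! ## Homogeneous quasimorphisms -/

section Quasimorphisms

/-- The defect `sup_{g, h} |φ(g) + φ(h) - φ(gh)|`. The supremum is taken in `ℝ`, so it is only
meaningful for quasimorphisms. -/
def defect {G : Type*} [Group G] (φ : G → ℝ) : ℝ :=
  ⨆ p : G × G, |φ p.1 + φ p.2 - φ (p.1 * p.2)|

/-- A quasimorphism: a real function whose defect is finite. -/
def IsQuasimorphism {G : Type*} [Group G] (φ : G → ℝ) : Prop :=
  BddAbove (Set.range fun p : G × G => |φ p.1 + φ p.2 - φ (p.1 * p.2)|)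

/-- Homogeneity: `φ(g ^ n) = n φ(g)` for all `g` and all integers `n`. -/
def IsHomogeneous {G : Type*} [Group G] (φ : G → ℝ) : Prop :=
  ∀ (g : G) (n : ℤ), φ (g ^ n) = n * φ g

/-- `Q(G)`, the real vector space of homogeneous quasimorphisms on `G`. -/
def homogQM (G : Type*) [Group G] : Submodule ℝ (G → ℝ) where
  carrier := {φ | IsQuasimorphism φ ∧ IsHomogeneous φ}
  add_mem' := by
    rintro φ ψ ⟨⟨C, hC⟩, hφ⟩ ⟨⟨D, hD⟩, hψ⟩
    refine ⟨⟨C + D, ?_⟩, ?_⟩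
    · rintro _ ⟨p, rfl⟩
      have h1 := hC ⟨p, rfl⟩
      have h2 := hD ⟨p, rfl⟩
      simp only [Pi.add_apply] at h1 h2 ⊢
      have h3 := abs_add_le (φ p.1 + φ p.2 - φ (p.1 * p.2)) (ψ p.1 + ψ p.2 - ψ (p.1 * p.2))
      have h4 : φ p.1 + ψ p.1 + (φ p.2 + ψ p.2) - (φ (p.1 * p.2) + ψ (p.1 * p.2)) =
        (φ p.1 + φ p.2 - φ (p.1 * p.2)) + (ψ p.1 + ψ p.2 - ψ (p.1 * p.2)) := by ring
      rw [h4]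
      linarith
    · intro g n
      simp only [Pi.add_apply, hφ g n, hψ g n]
      ring
  zero_mem' := by
    refine ⟨⟨0, ?_⟩, ?_⟩
    · rintro _ ⟨p, rfl⟩
      simp
    · intro g n
      simp
  smul_mem' := by
    rintro r φ ⟨⟨C, hC⟩, hφ⟩
    refine ⟨⟨|r| * C, ?_⟩, ?_⟩
    · rintro _ ⟨p, rfl⟩
      have h1 := hC ⟨p, rfl⟩
      simp only [Pi.smul_apply, smul_eq_mul] at h1 ⊢
      have h4 : r * φ p.1 + r * φ p.2 - r * φ (p.1 * p.2) =
        r * (φ p.1 + φ p.2 - φ (p.1 * p.2)) := by ring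
      rw [h4, abs_mul]
      exact mul_le_mul_of_nonneg_left h1 (abs_nonneg r)
    · intro g n
      simp only [Pi.smul_apply, smul_eq_mul, hφ g n]
      ring

/-- `Hom(G)`, the real-valued homomorphisms, as a subspace of `Q(G)`. (Every homomorphism to `ℝ` is
a homogeneous quasimorphism, so nothing is lost by working inside `Q(G)`.) -/
def homs (G : Type*) [Group G] : Submodule ℝ (homogQM G) where
  carrier := {φ | ∀ g h : G, φ.1 (g * h) = φ.1 g + φ.1 h}
  add_mem' := by
    intro φ ψ hφ hψ g h
    have h1 := hφ g h
    have h2 := hψ g h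
    simp only [Submodule.coe_add, Pi.add_apply, h1, h2]
    ring
  zero_mem' := by
    intro g h
    simp
  smul_mem' := by
    intro r φ hφ g h
    have h1 := hφ g h
    simp only [Submodule.coe_smul, Pi.smul_apply, smul_eq_mul, h1]
    ring

/-- The pullback `Q(G₂) → Q(G₁)`, `φ ↦ φ ∘ f`, along a homomorphism `f : G₁ → G₂`. -/
def pullback {G₁ G₂ : Type*} [Group G₁] [Group G₂] (f : G₁ →* G₂) :
    homogQM G₂ →ₗ[ℝ] homogQM G₁ where
  toFun φ := ⟨fun g => φ.1 (f g), by
    obtain ⟨φ, ⟨C, hC⟩, hφ⟩ := φ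
    refine ⟨⟨C, ?_⟩, ?_⟩
    · rintro _ ⟨p, rfl⟩
      have h1 := hC ⟨(f p.1, f p.2), rfl⟩
      simpa using h1
    · intro g n
      simpa using hφ (f g) n⟩
  map_add' _ _ := rfl
  map_smul' _ _ := rfl

/-- The map `Q(G₂)/Hom(G₂) → Q(G₁)/Hom(G₁)` induced by the pullback. -/
def quotientPullback {G₁ G₂ : Type*} [Group G₁] [Group G₂] (f : G₁ →* G₂) :
    (homogQM G₂ ⧸ homs G₂) →ₗ[ℝ] (homogQM G₁ ⧸ homs G₁) :=
  (homs G₂).mapQ (homs G₁) (pullback f) (by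
    intro φ hφ g h
    have h1 := hφ (f g) (f h)
    simpa [pullback] using h1)

end Quasimorphisms

/-! ## Stable commutator length of chains -/

section Chains

/-- `g` is a product of `k` commutators. -/
def IsProdOfCommutators {G : Type*} [Group G] (k : ℕ) (g : G) : Prop :=
  ∃ l : List (G × G), l.length = k ∧ (l.map fun p => p.1 * p.2 * p.1⁻¹ * p.2⁻¹).prod = g

/-- The commutator length of `g₁ + ⋯ + gₘ`, where the `gᵢ` are the elements of the multiset `s`: the
least number of commutators whose product is of the form `∏ tᵢ gᵢ tᵢ⁻¹`, and `∞` if there is no such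
product. A list of pairs `(tᵢ, gᵢ)` encodes such an expression. -/
def cl {G : Type*} [Group G] (s : Multiset G) : ℕ∞ :=
  ⨅ (k : ℕ) (_ : ∃ L : List (G × G), ((L.map Prod.snd : List G) : Multiset G) = s ∧
    IsProdOfCommutators k (L.map fun p => p.1 * p.2 * p.1⁻¹).prod), (k : ℕ∞)

/-- `scl(g₁ + ⋯ + gₘ) = lim cl(g₁ⁿ + ⋯ + gₘⁿ) / n`. If `g₁ ⋯ gₘ` lies in the commutator subgroup,
the sequence converges. If only `(g₁ ⋯ gₘ) ^ k` lies in the commutator subgroup for some `k ≥ 1`,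
then the sequence is `∞` away from the multiples of the least such `k`, and the lower limit is the
limit along these multiples. Otherwise the sequence is eventually `∞`. -/
def sclMultiset {G : Type*} [Group G] (s : Multiset G) : ℝ≥0∞ :=
  liminf (fun n : ℕ => ((cl (s.map fun g => g ^ n) : ℕ∞) : ℝ≥0∞) / (n : ℝ≥0∞)) atTop

/-- The sum of group elements, with repetitions, that represents an integral chain `∑ aᵢ gᵢ`: here
`-g` is represented by `g⁻¹`. -/
def integralToMultiset {G : Type*} [Group G] (a : G →₀ ℤ) : Multiset G :=
  a.sum fun g k => Multiset.replicate k.natAbs (g ^ k.sign)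

/-- Extension to rational chains by homogeneity: `scl(c) = scl(N c) / N` for every `N ≥ 1` such that
`N c` is integral. The value does not depend on `N`; the infimum is this common value. -/
def sclRat {G : Type*} [Group G] (c : G →₀ ℚ) : ℝ≥0∞ :=
  ⨅ (N : ℕ) (a : G →₀ ℤ) (_ : 0 < N ∧ ∀ g, (a g : ℚ) = N * c g),
    sclMultiset (integralToMultiset a) / (N : ℝ≥0∞)

/-- `B₁(G)`, the boundaries among the real chains `C₁(G) = (G →₀ ℝ)`: the subspace spanned by the
boundaries `g + h - gh` of the 2-simplices `(g, h)`. -/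
def B₁ (G : Type*) [Group G] : Submodule ℝ (G →₀ ℝ) :=
  Submodule.span ℝ (Set.range fun p : G × G =>
    Finsupp.single p.1 (1 : ℝ) + Finsupp.single p.2 1 - Finsupp.single (p.1 * p.2) 1)

/-- A rational chain as a real chain. -/
def ratToReal {G : Type*} (q : G →₀ ℚ) : G →₀ ℝ :=
  q.mapRange (fun x : ℚ => (x : ℝ)) Rat.cast_zero

/-- Rational boundaries `q` supported in the support of `c` and converging to `c`, that is, with
coefficients converging to those of `c`. -/
def ratApprox {G : Type*} [Group G] (c : G →₀ ℝ) : Filter (G →₀ ℚ) :=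
  comap (fun (q : G →₀ ℚ) (g : G) => (q g : ℝ)) (𝓝 (fun g => c g)) ⊓
    𝓟 {q | q.support ⊆ c.support ∧ ratToReal q ∈ B₁ G}

open Classical in
/-- Stable commutator length on `C₁(G)`: the continuous extension from rational boundaries to real
boundaries, and `∞` outside of `B₁(G)`. -/
def scl {G : Type*} [Group G] (c : G →₀ ℝ) : ℝ≥0∞ :=
  if c ∈ B₁ G then liminf sclRat (ratApprox c) else ⊤

/-! ## Homogeneous chains and isometric maps -/

/-- The subspace of `C₁(G)` spanned by all `gⁿ - n g` and all `h g h⁻¹ - g`. -/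
def homogRel (G : Type*) [Group G] : Submodule ℝ (G →₀ ℝ) :=
  Submodule.span ℝ
    ({c | ∃ (g : G) (n : ℤ), c = Finsupp.single (g ^ n) (1 : ℝ) - (n : ℝ) • Finsupp.single g 1} ∪
     {c | ∃ g h : G, c = Finsupp.single (h * g * h⁻¹) (1 : ℝ) - Finsupp.single g 1})

/-- `C₁ᴴ(G)`, the space of homogeneous chains. -/
abbrev C₁H (G : Type*) [Group G] : Type _ := (G →₀ ℝ) ⧸ homogRel G

/-- The function induced by `scl` on `C₁ᴴ(G)`. All chains that represent a given class have the same
`scl`; the infimum is this common value. -/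
def sclH {G : Type*} [Group G] (x : C₁H G) : ℝ≥0∞ :=
  ⨅ (c : G →₀ ℝ) (_ : (homogRel G).mkQ c = x), scl c

/-- The map `C₁ᴴ(G₁) → C₁ᴴ(G₂)` induced by a homomorphism. -/
def C₁H.map {G₁ G₂ : Type*} [Group G₁] [Group G₂] (f : G₁ →* G₂) : C₁H G₁ →ₗ[ℝ] C₁H G₂ :=
  (homogRel G₁).mapQ (homogRel G₂) (Finsupp.lmapDomain ℝ ℝ f) (by
    rw [homogRel, Submodule.span_le]
    rintro c (⟨g, n, rfl⟩ | ⟨g, h, rfl⟩)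
    · refine Submodule.subset_span (Or.inl ⟨f g, n, ?_⟩)
      rw [map_sub, map_smul]
      simp only [Finsupp.lmapDomain_apply, Finsupp.mapDomain_single, map_zpow]
    · refine Submodule.subset_span (Or.inr ⟨f g, f h, ?_⟩)
      rw [map_sub]
      simp only [Finsupp.lmapDomain_apply, Finsupp.mapDomain_single, map_mul, map_inv])

/-- A homomorphism is isometric for `scl` if the induced map on homogeneous chains preserves `scl`
(including the value `∞`). -/
def IsIsometric {G₁ G₂ : Type*} [Group G₁] [Group G₂] (f : G₁ →* G₂) : Prop :=
  ∀ x : C₁H G₁, sclH (C₁H.map f x) = sclH x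

end Chains

end Scl

end

/-! Homogeneous quasimorphisms are functionals on homogeneous chains, and the theorem is a Hahn–Banach
extension of such a functional. Two elementary estimates compare defects with `scl`.

* A homogeneous quasimorphism `φ` is conjugation invariant and is at most `D(φ)` on commutators, so
  it is at most about `2 k D(φ)` on products of `k` commutators. Hence `|φ(x)| ≤ 2 D(φ) scl(x)` for
  every homogeneous chain `x` (`abs_evalC₁H_le_of_sclH_lt`).
* `gⁿhⁿ(gh)⁻ⁿ` is a product of `n / 2` commutators for even `n`
  (`IsProdOfCommutators.pow_mul_pow_mul_pow_inv`), so `scl(g + h - gh) ≤ 1 / 2`. More generally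
  `scl(∑ rᵢ (gᵢ + hᵢ - gᵢhᵢ)) ≤ ∑ |rᵢ| / 2` (`sclH_boundaryH_le`): for integral `rᵢ` one removes the
  pairs `x`, `x⁻¹` that cancel in the chain, at the cost of boundedly many commutators, and real
  `rᵢ` are approximated by rational ones through `ℚ`-linear maps `ℝ → ℚ`, which preserve the support
  of the chain.

Let `f` be isometric and let `φ₁` be a homogeneous quasimorphism on `G₁`, viewed as a functional on
`C₁ᴴ(G₁)`. If the image of `x` in `C₁ᴴ(G₂)` is the boundary of a 2-chain `r`, then `scl(x)` is at
most `‖r‖₁ / 2`, whence `|φ₁(x)| ≤ D(φ₁) ‖r‖₁`. With `r = 0` this shows that `φ₁` factors through the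
image of `C₁ᴴ(G₁)`. In general it allows the Hahn–Banach theorem to be applied on the space of
2-chains of `G₂` with its `ℓ¹`-norm: the functional given by `φ₁` on the 2-chains whose boundary
comes from `G₁` extends with the same bound `D(φ₁)`. The extension vanishes on cycles and so gives a
functional on the boundaries of `G₂` that is compatible with `φ₁` on the intersection with the image
of `C₁ᴴ(G₁)`. Any common extension to `C₁ᴴ(G₂)` restricts on group elements to a homogeneous quasimorphism on `G₂`,
whose defect is the norm on the 2-simplices, that is, at most `D(φ₁)`. -/

namespace Scl

/-! ### Homogeneous quasimorphisms -/

section Quasimorphisms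

variable {G : Type*} [Group G] {φ : G → ℝ}

lemma defect_nonneg (φ : G → ℝ) : 0 ≤ defect φ :=
  Real.iSup_nonneg fun _ => abs_nonneg _

lemma abs_add_sub_mul_le_defect (hφ : φ ∈ homogQM G) (g h : G) :
    |φ g + φ h - φ (g * h)| ≤ defect φ :=
  le_ciSup hφ.1 (g, h)

lemma map_one_of_mem_homogQM (hφ : φ ∈ homogQM G) : φ 1 = 0 := by
  simpa using hφ.2 1 0

lemma map_inv_of_mem_homogQM (hφ : φ ∈ homogQM G) (g : G) : φ g⁻¹ = -φ g := by
  simpa using hφ.2 g (-1)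

lemma map_pow_of_mem_homogQM (hφ : φ ∈ homogQM G) (g : G) (n : ℕ) : φ (g ^ n) = n * φ g := by
  simpa using hφ.2 g n

/-- Conjugation changes the value by at most twice the defect, hence by nothing: apply this bound to
all powers of `g`. -/
lemma map_conj_of_mem_homogQM (hφ : φ ∈ homogQM G) (t g : G) : φ (t * g * t⁻¹) = φ g := by
  have key : ∀ n : ℕ, n • |φ (t * g * t⁻¹) - φ g| ≤ 2 * defect φ := by
    intro n
    have h1 := abs_add_sub_mul_le_defect hφ (t * g ^ n) t⁻¹
    have h2 := abs_add_sub_mul_le_defect hφ t (g ^ n)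
    rw [map_inv_of_mem_homogQM hφ, ← conj_pow, map_pow_of_mem_homogQM hφ] at h1
    rw [map_pow_of_mem_homogQM hφ] at h2
    rw [nsmul_eq_mul, ← Nat.abs_cast n, ← abs_mul]
    rw [abs_le] at h1 h2 ⊢
    constructor <;> linarith
  have hle : |φ (t * g * t⁻¹) - φ g| ≤ 0 := by
    by_contra! hpos
    obtain ⟨n, hn⟩ := Archimedean.arch (2 * defect φ + 1) hpos
    linarith [key n]
  exact sub_eq_zero.mp (abs_nonpos_iff.mp hle)

lemma abs_map_commutator_le_defect (hφ : φ ∈ homogQM G) (a b : G) :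
    |φ (a * b * a⁻¹ * b⁻¹)| ≤ defect φ := by
  have h1 := abs_add_sub_mul_le_defect hφ (a * b * a⁻¹) b⁻¹
  rwa [map_inv_of_mem_homogQM hφ, map_conj_of_mem_homogQM hφ, add_neg_cancel, zero_sub,
    abs_neg] at h1

lemma abs_map_prod_sub_sum_le (hφ : φ ∈ homogQM G) (l : List G) :
    |φ l.prod - (l.map φ).sum| ≤ l.length * defect φ := by
  induction l with
  | nil => simp [map_one_of_mem_homogQM hφ]
  | cons g l ih =>
    have h1 := abs_add_sub_mul_le_defect hφ g l.prod
    simp only [List.prod_cons, List.map_cons, List.sum_cons, List.length_cons]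
    push_cast
    rw [abs_le] at h1 ih ⊢
    constructor <;> linarith

lemma abs_map_le_of_isProdOfCommutators (hφ : φ ∈ homogQM G) {k : ℕ} {g : G}
    (hg : IsProdOfCommutators k g) : |φ g| ≤ 2 * k * defect φ := by
  obtain ⟨l, rfl, rfl⟩ := hg
  have h1 := abs_map_prod_sub_sum_le hφ (l.map fun p => p.1 * p.2 * p.1⁻¹ * p.2⁻¹)
  have h2 : |((l.map fun p => p.1 * p.2 * p.1⁻¹ * p.2⁻¹).map φ).sum| ≤ l.length * defect φ := by
    clear h1
    induction l with
    | nil => simp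
    | cons p l ih =>
      have h3 := abs_map_commutator_le_defect hφ p.1 p.2
      simp only [List.map_cons, List.sum_cons, List.length_cons]
      push_cast
      rw [abs_le] at h3 ih ⊢
      constructor <;> linarith
  rw [List.length_map] at h1
  rw [abs_le] at h1 h2 ⊢
  constructor <;> linarith

end Quasimorphisms

/-! ### Quasimorphisms are bounded by stable commutator length -/

section LowerBound

variable {G : Type*} [Group G] {φ : G → ℝ}

lemma exists_isProdOfCommutators_of_cl_le {s : Multiset G} {k : ℕ} (hk : cl s ≤ k) :
    ∃ i ≤ k, ∃ L : List (G × G), ((L.map Prod.snd : List G) : Multiset G) = s ∧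
      IsProdOfCommutators i (L.map fun p => p.1 * p.2 * p.1⁻¹).prod := by
  have hlt : cl s < ((k + 1 : ℕ) : ℕ∞) := hk.trans_lt (by exact_mod_cast Nat.lt_succ_self k)
  rw [cl] at hlt
  simp only [iInf_lt_iff] at hlt
  obtain ⟨i, hi, hik⟩ := hlt
  exact ⟨i, Nat.lt_succ_iff.mp (by exact_mod_cast hik), hi⟩

lemma abs_sum_map_le_of_cl_le (hφ : φ ∈ homogQM G) {s : Multiset G} {k : ℕ} (hk : cl s ≤ k) :
    |(s.map φ).sum| ≤ (s.card + 2 * k) * defect φ := by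
  obtain ⟨i, hik, L, rfl, hL⟩ := exists_isProdOfCommutators_of_cl_le hk
  have h1 := abs_map_prod_sub_sum_le hφ (L.map fun p => p.1 * p.2 * p.1⁻¹)
  have h2 := abs_map_le_of_isProdOfCommutators hφ hL
  have h3 : (L.map fun p => p.1 * p.2 * p.1⁻¹).map φ = (L.map Prod.snd).map φ := by
    simp [List.map_map, Function.comp_def, map_conj_of_mem_homogQM hφ]
  have h4 : 2 * (i : ℝ) * defect φ ≤ 2 * k * defect φ :=
    mul_le_mul_of_nonneg_right (by exact_mod_cast Nat.mul_le_mul_left 2 hik) (defect_nonneg φ)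
  rw [h3, List.length_map] at h1
  rw [Multiset.map_coe, Multiset.sum_coe, Multiset.coe_card, List.length_map]
  rw [abs_le] at h1 h2 ⊢
  constructor <;> linarith

/-- The bound `|∑ φ(gᵢ)| ≤ 2 D(φ) scl(∑ gᵢ)`, in a form that makes sense without a convention for
`0 * ∞`. -/
lemma abs_sum_map_le_of_sclMultiset_lt (hφ : φ ∈ homogQM G) {s : Multiset G} {M : ℝ}
    (hM : sclMultiset s < ENNReal.ofReal M) : |(s.map φ).sum| ≤ 2 * defect φ * M := by
  have hM0 : 0 < M := ENNReal.ofReal_pos.mp (bot_le.trans_lt hM)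
  have hfreq := (frequently_lt_of_liminf_lt (by isBoundedDefault) hM).and_eventually
    (eventually_gt_atTop 0)
  have hlim : Tendsto (fun n : ℕ => (s.card : ℝ) * defect φ / n + 2 * defect φ * M) atTop
      (𝓝 (0 + 2 * defect φ * M)) :=
    (tendsto_const_div_atTop_nhds_zero_nat _).add_const _
  rw [zero_add] at hlim
  refine ge_of_tendsto_of_frequently hlim (hfreq.mono ?_)
  rintro n ⟨hn, hn0⟩
  have hn0' : (0 : ℝ) < n := by exact_mod_cast hn0
  rw [ENNReal.div_lt_iff (Or.inl (by exact_mod_cast hn0.ne')) (Or.inl (by simp))] at hn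
  obtain ⟨k, hk⟩ : ∃ k : ℕ, cl (s.map fun g => g ^ n) = k := by
    refine (ENat.ne_top_iff_exists.mp ?_).imp fun _ h => h.symm
    intro htop
    simp [htop] at hn
  have hkM : (k : ℝ) ≤ M * n := by
    rw [hk, ← ENNReal.ofReal_natCast n, ← ENNReal.ofReal_mul hM0.le] at hn
    have h5 : ENNReal.ofReal (k : ℝ) < ENNReal.ofReal (M * n) := by simpa using hn
    exact ((ENNReal.ofReal_lt_ofReal_iff_of_nonneg (Nat.cast_nonneg k)).mp h5).le
  have h1 := abs_sum_map_le_of_cl_le hφ hk.le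
  have h2 : ((s.map fun g => g ^ n).map φ).sum = n * (s.map φ).sum := by
    simp [Multiset.map_map, map_pow_of_mem_homogQM hφ, Multiset.sum_map_mul_left]
  rw [h2, abs_mul, Nat.abs_cast, Multiset.card_map] at h1
  have h3 : (s.card + 2 * (k : ℝ)) * defect φ ≤ (s.card + 2 * (M * n)) * defect φ :=
    mul_le_mul_of_nonneg_right (by linarith) (defect_nonneg φ)
  rw [← mul_le_mul_iff_right₀ hn0']
  calc (n : ℝ) * |(s.map φ).sum| ≤ (s.card + 2 * (M * n)) * defect φ := h1.trans h3
    _ = n * (s.card * defect φ / n + 2 * defect φ * M) := by field_simp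

lemma sum_map_integralToMultiset (hφ : φ ∈ homogQM G) (a : G →₀ ℤ) :
    ((integralToMultiset a).map φ).sum = a.sum fun g k => k * φ g := by
  have h1 := map_finsuppSum ((Multiset.sumAddMonoidHom).comp (Multiset.mapAddMonoidHom φ)) a
    (fun g k => Multiset.replicate k.natAbs (g ^ k.sign))
  refine h1.trans (Finsupp.sum_congr fun g _ => ?_)
  simp only [AddMonoidHom.coe_comp, Function.comp_apply, Multiset.mapAddMonoidHom_apply,
    Multiset.coe_sumAddMonoidHom, Multiset.map_replicate, Multiset.sum_replicate,
    nsmul_eq_mul]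
  rw [hφ.2 g, ← mul_assoc]
  congr 1
  rw [mul_comm]
  simpa using congrArg (Int.cast : ℤ → ℝ) (Int.sign_mul_natAbs (a g))

lemma abs_linearCombination_le_of_sclRat_lt (hφ : φ ∈ homogQM G) {q : G →₀ ℚ} {M : ℝ}
    (hM : sclRat q < ENNReal.ofReal M) :
    |Finsupp.linearCombination ℝ φ (ratToReal q)| ≤ 2 * defect φ * M := by
  have hM0 : 0 < M := ENNReal.ofReal_pos.mp (bot_le.trans_lt hM)
  rw [sclRat] at hM
  simp only [iInf_lt_iff] at hM
  obtain ⟨N, a, ⟨hN, ha⟩, hlt⟩ := hM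
  have hN' : (0 : ℝ) < N := by exact_mod_cast hN
  rw [ENNReal.div_lt_iff (Or.inl (by exact_mod_cast hN.ne')) (Or.inl (by simp)),
    ← ENNReal.ofReal_natCast N, ← ENNReal.ofReal_mul hM0.le] at hlt
  have h1 := abs_sum_map_le_of_sclMultiset_lt hφ hlt
  have h2 : a.mapRange (Int.cast : ℤ → ℝ) Int.cast_zero = (N : ℝ) • ratToReal q := by
    ext g
    simp only [Finsupp.mapRange_apply, Finsupp.smul_apply, ratToReal, smul_eq_mul]
    exact_mod_cast congrArg (Rat.cast : ℚ → ℝ) (ha g)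
  have h3 : ((integralToMultiset a).map φ).sum =
      N * Finsupp.linearCombination ℝ φ (ratToReal q) := by
    rw [sum_map_integralToMultiset hφ, ← smul_eq_mul (N : ℝ), ← map_smul, ← h2,
      Finsupp.linearCombination_apply, Finsupp.sum_mapRange_index (by simp)]
    simp
  rw [h3, abs_mul, Nat.abs_cast] at h1
  rw [← mul_le_mul_iff_right₀ hN']
  linarith

lemma tendsto_linearCombination_ratApprox (φ : G → ℝ) (c : G →₀ ℝ) :
    Tendsto (fun q => Finsupp.linearCombination ℝ φ (ratToReal q)) (ratApprox c)
      (𝓝 (Finsupp.linearCombination ℝ φ c)) := by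
  have hcoord : ∀ g, Tendsto (fun q : G →₀ ℚ => (q g : ℝ)) (ratApprox c) (𝓝 (c g)) :=
    tendsto_pi_nhds.mp (tendsto_comap.mono_left inf_le_left)
  have hsum : Tendsto (fun q : G →₀ ℚ => ∑ g ∈ c.support, (q g : ℝ) • φ g) (ratApprox c)
      (𝓝 (∑ g ∈ c.support, c g • φ g)) :=
    tendsto_finsetSum _ fun g _ => (hcoord g).smul_const _
  rw [Finsupp.linearCombination_apply, Finsupp.sum]
  refine hsum.congr' ?_
  have hmem : ∀ᶠ q in ratApprox c, q.support ⊆ c.support ∧ ratToReal q ∈ B₁ G :=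
    mem_inf_of_right (mem_principal_self _)
  filter_upwards [hmem] with q hq
  have hsupp : (ratToReal q).support ⊆ c.support := Finsupp.support_mapRange.trans hq.1
  rw [Finsupp.linearCombination_apply, Finsupp.sum_of_support_subset _ hsupp _ (by simp)]
  simp [ratToReal]

lemma abs_linearCombination_le_of_scl_lt (hφ : φ ∈ homogQM G) {c : G →₀ ℝ} {M : ℝ}
    (hM : scl c < ENNReal.ofReal M) :
    |Finsupp.linearCombination ℝ φ c| ≤ 2 * defect φ * M := by
  rw [scl] at hM
  split_ifs at hM with hc
  · exact le_of_tendsto_of_frequently (tendsto_linearCombination_ratApprox φ c).abs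
      ((frequently_lt_of_liminf_lt (by isBoundedDefault) hM).mono
        fun q hq => abs_linearCombination_le_of_sclRat_lt hφ hq)
  · simp at hM

/-- A homogeneous quasimorphism as a linear functional on homogeneous chains. -/
noncomputable def evalC₁H (hφ : φ ∈ homogQM G) : C₁H G →ₗ[ℝ] ℝ :=
  (homogRel G).liftQ (Finsupp.linearCombination ℝ φ) (by
    rw [homogRel, Submodule.span_le]
    rintro c (⟨g, n, rfl⟩ | ⟨g, h, rfl⟩)
    · simp [hφ.2 g n]
    · simp [map_conj_of_mem_homogQM hφ])

/-- The easy inequality of Bavard duality: `|φ(x)| ≤ 2 D(φ) scl(x)` for homogeneous chains `x`. -/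
lemma abs_evalC₁H_le_of_sclH_lt (hφ : φ ∈ homogQM G) {x : C₁H G} {M : ℝ}
    (hM : sclH x < ENNReal.ofReal M) : |evalC₁H hφ x| ≤ 2 * defect φ * M := by
  rw [sclH] at hM
  simp only [iInf_lt_iff] at hM
  obtain ⟨c, rfl, hc⟩ := hM
  exact abs_linearCombination_le_of_scl_lt hφ hc

end LowerBound

/-! ### Products of commutators -/

section Commutators

variable {G : Type*} [Group G]

namespace IsProdOfCommutators

lemma one (k : ℕ) : IsProdOfCommutators k (1 : G) :=
  ⟨List.replicate k (1, 1), by simp, by simp⟩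

lemma commutator (a b : G) : IsProdOfCommutators 1 (a * b * a⁻¹ * b⁻¹) :=
  ⟨[(a, b)], rfl, by simp⟩

lemma mul {k l : ℕ} {x y : G} (hx : IsProdOfCommutators k x) (hy : IsProdOfCommutators l y) :
    IsProdOfCommutators (k + l) (x * y) := by
  obtain ⟨lx, rfl, rfl⟩ := hx
  obtain ⟨ly, rfl, rfl⟩ := hy
  exact ⟨lx ++ ly, by simp, by simp⟩

lemma conj {k : ℕ} {x : G} (hx : IsProdOfCommutators k x) (t : G) :
    IsProdOfCommutators k (t * x * t⁻¹) := by
  obtain ⟨l, rfl, rfl⟩ := hx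
  refine ⟨l.map (Prod.map (MulAut.conj t) (MulAut.conj t)), by simp, ?_⟩
  rw [← MulAut.conj_apply, map_list_prod, List.map_map, List.map_map]
  congr 2
  funext p
  simp only [Function.comp_apply, Prod.map_fst, Prod.map_snd, map_mul, map_inv]

/-- Replacing a factor `x` of a product by `y` costs as many commutators as `y * x⁻¹`. -/
lemma replace {k l : ℕ} {a b x y : G} (h : IsProdOfCommutators k (a * x * b))
    (hxy : IsProdOfCommutators l (y * x⁻¹)) : IsProdOfCommutators (k + l) (a * y * b) := by
  have h1 := (hxy.conj a).mul h
  rw [add_comm k]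
  convert h1 using 1
  group

/-- Reversing the order of three blocks costs a single commutator. This is more economical than
successive exchanges of two blocks, and it is what yields the sharp constant. -/
lemma reverse_three (x y z : G) : IsProdOfCommutators 1 (x * y * z * (z * y * x)⁻¹) := by
  convert commutator (x * y) (z * x⁻¹) using 1
  group

lemma swap (x y : G) : IsProdOfCommutators 1 (x * y * (y * x)⁻¹) := by
  simpa using reverse_three x 1 y

/-- The thrice-punctured sphere with boundary `g`, `h`, `(gh)⁻¹` has Euler characteristic `-1`; its
covers of degree `n` explain why `gⁿhⁿ(gh)⁻ⁿ` is a product of about `n / 2` commutators. The inductive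
step rewrites `hⁿ (gh) g` as `g (gh) hⁿ`, which merges two letters `g` and two letters `h` with the
powers collected so far, at the cost of one commutator. -/
lemma pow_mul_pow_mul_pow_inv (g h : G) (m : ℕ) :
    IsProdOfCommutators m (g ^ (2 * m) * h ^ (2 * m) * ((g * h)⁻¹) ^ (2 * m)) := by
  induction m with
  | zero => simpa using one (G := G) 0
  | succ m ih =>
    have h1 : g ^ (2 * m) * h ^ (2 * m) * ((g * h)⁻¹) ^ (2 * m) =
        g ^ (2 * m) * (h ^ (2 * m) * (g * h) * g) *
          (h * ((g * h)⁻¹) ^ 2 * ((g * h)⁻¹) ^ (2 * m)) := by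
      rw [pow_two]
      group
    rw [h1] at ih
    have h2 := ih.replace (reverse_three g (g * h) (h ^ (2 * m)))
    convert h2 using 1
    generalize (g * h)⁻¹ = u
    group

end IsProdOfCommutators


/-- Some ordering of the elements of `s` has a product that is a product of `k` commutators. -/
def IsCommutatorMultiset (k : ℕ) (s : Multiset G) : Prop :=
  ∃ l : List G, (l : Multiset G) = s ∧ IsProdOfCommutators k l.prod

namespace IsCommutatorMultiset

lemma cl_le {k : ℕ} {s : Multiset G} (h : IsCommutatorMultiset k s) : cl s ≤ k := by
  obtain ⟨l, rfl, hl⟩ := h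
  exact iInf₂_le k ⟨l.map fun g => (1, g), by simp [Function.comp_def],
    by simpa [Function.comp_def] using hl⟩

lemma add {k l : ℕ} {s t : Multiset G} (hs : IsCommutatorMultiset k s)
    (ht : IsCommutatorMultiset l t) : IsCommutatorMultiset (k + l) (s + t) := by
  obtain ⟨ls, rfl, hs⟩ := hs
  obtain ⟨lt, rfl, ht⟩ := ht
  exact ⟨ls ++ lt, by simp, by simpa using hs.mul ht⟩

/-- Any element can be moved to the front at the cost of one commutator. -/
lemma exists_cons {k : ℕ} {x : G} {s : Multiset G} (h : IsCommutatorMultiset k (x ::ₘ s)) :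
    ∃ l : List G, (l : Multiset G) = s ∧ IsProdOfCommutators (k + 1) (x * l.prod) := by
  obtain ⟨l, hls, hl⟩ := h
  have hx : x ∈ l := by
    rw [← Multiset.mem_coe, hls]
    exact Multiset.mem_cons_self x s
  obtain ⟨a, b, rfl⟩ := List.append_of_mem hx
  refine ⟨a ++ b, ?_, ?_⟩
  · rw [← Multiset.cons_inj_right x, ← hls, Multiset.cons_coe, Multiset.coe_eq_coe]
    exact List.perm_middle.symm
  · have h1 : IsProdOfCommutators k (1 * (a.prod * x) * b.prod) := by
      simpa [mul_assoc] using hl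
    simpa [mul_assoc] using h1.replace (IsProdOfCommutators.swap x a.prod)

/-- A pair of inverse elements can be removed at the cost of two commutators. -/
lemma of_cons_cons_inv {k : ℕ} {x : G} {s : Multiset G}
    (h : IsCommutatorMultiset k (x ::ₘ x⁻¹ ::ₘ s)) : IsCommutatorMultiset (k + 2) s := by
  obtain ⟨l, hls, hl⟩ := h.exists_cons
  have hx : x⁻¹ ∈ l := by
    rw [← Multiset.mem_coe, hls]
    exact Multiset.mem_cons_self _ s
  obtain ⟨a, b, rfl⟩ := List.append_of_mem hx
  refine ⟨a ++ b, ?_, ?_⟩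
  · rw [← Multiset.cons_inj_right x⁻¹, ← hls, Multiset.cons_coe, Multiset.coe_eq_coe]
    exact List.perm_middle.symm
  · have h1 : IsProdOfCommutators (k + 1) (x * (a.prod * x⁻¹) * b.prod) := by
      simpa [mul_assoc] using hl
    simpa [mul_assoc] using h1.replace (IsProdOfCommutators.swap x⁻¹ a.prod)

end IsCommutatorMultiset

end Commutators

/-! ### The upper bound for integral boundaries -/

section IntegralChains

variable {G : Type*} [Group G]

lemma integralToMultiset_single_add (g : G) (k : ℤ) {b : G →₀ ℤ} (hb : b g = 0) :
    integralToMultiset (Finsupp.single g k + b) =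
      Multiset.replicate k.natAbs (g ^ k.sign) + integralToMultiset b := by
  rw [integralToMultiset, Finsupp.sum_add_index_of_disjoint, Finsupp.sum_single_index (by simp)]
  · rfl
  · refine Finset.disjoint_of_subset_left Finsupp.support_single_subset ?_
    simpa using hb

/-- Up to a pair `x`, `x⁻¹` that cancels, adding `±g` to an integral chain adds `g ^ (±1)` to the
multiset that represents it; `s` stands for further elements that are kept. -/
lemma IsCommutatorMultiset.integralToMultiset_single_add {k n : ℕ} {g : G} {ε : ℤ}
    (hε : ε = 1 ∨ ε = -1) {a : G →₀ ℤ} {s : Multiset G}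
    (h : IsCommutatorMultiset k (((g ^ ε) ::ₘ (integralToMultiset a + s)).map fun x => x ^ n)) :
    IsCommutatorMultiset (k + 2)
      ((integralToMultiset (Finsupp.single g ε + a) + s).map fun x => x ^ n) := by
  have hweak : ∀ {s : Multiset G}, IsCommutatorMultiset k s → IsCommutatorMultiset (k + 2) s := by
    intro s hs
    simpa using hs.add ⟨[], rfl, IsProdOfCommutators.one 2⟩
  obtain ⟨j, b, hb, rfl⟩ : ∃ (j : ℤ) (b : G →₀ ℤ), b g = 0 ∧ a = Finsupp.single g j + b :=
    ⟨a g, a.erase g, Finsupp.erase_same, (Finsupp.single_add_erase g a).symm⟩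
  rw [← add_assoc, ← Finsupp.single_add, Scl.integralToMultiset_single_add _ _ hb,
    add_assoc]
  rw [Scl.integralToMultiset_single_add _ _ hb, add_assoc] at h
  generalize integralToMultiset b + s = t at h ⊢
  have hpos : ∀ i : ℕ, Multiset.replicate ((i : ℤ).natAbs) (g ^ (i : ℤ).sign) =
      Multiset.replicate i g := by
    rintro (_ | i)
    · simp
    · rw [Int.sign_natCast_of_ne_zero i.succ_ne_zero, zpow_one, Int.natAbs_natCast]
  have hneg : ∀ i : ℕ, Multiset.replicate ((-(i : ℤ)).natAbs) (g ^ (-(i : ℤ)).sign) =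
      Multiset.replicate i g⁻¹ := by
    rintro (_ | i)
    · simp
    · rw [Int.sign_neg, Int.sign_natCast_of_ne_zero i.succ_ne_zero, zpow_neg_one, Int.natAbs_neg,
        Int.natAbs_natCast]
  obtain ⟨i, rfl | rfl⟩ := j.eq_nat_or_neg <;> rcases hε with rfl | rfl
  · rw [hpos] at h
    rw [show (1 : ℤ) + i = ((i + 1 : ℕ) : ℤ) by push_cast; ring, hpos, Multiset.replicate_succ,
      Multiset.cons_add]
    simpa using hweak h
  · rw [hpos] at h
    cases i with
    | zero =>
      have := hneg 1
      simp only [Nat.cast_one] at this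
      simp only [Nat.cast_zero, add_zero]
      rw [this]
      simpa using hweak h
    | succ i =>
      rw [show (-1 : ℤ) + ((i + 1 : ℕ) : ℤ) = (i : ℤ) by push_cast; ring, hpos]
      refine IsCommutatorMultiset.of_cons_cons_inv (x := (g ^ n)⁻¹) ?_
      simpa [Multiset.replicate_succ] using h
  · rw [hneg] at h
    cases i with
    | zero =>
      have := hpos 1
      simp only [Nat.cast_one] at this
      simp only [Nat.cast_zero, neg_zero, add_zero]
      rw [this]
      simpa using hweak h
    | succ i =>
      rw [show (1 : ℤ) + -((i + 1 : ℕ) : ℤ) = -(i : ℤ) by push_cast; ring, hneg]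
      refine IsCommutatorMultiset.of_cons_cons_inv (x := g ^ n) ?_
      simpa [Multiset.replicate_succ] using h
  · rw [hneg] at h
    rw [show (-1 : ℤ) + -(i : ℤ) = -((i + 1 : ℕ) : ℤ) by push_cast; ring, hneg,
      Multiset.replicate_succ, Multiset.cons_add]
    simpa using hweak h

/-- The boundary map from 2-chains to 1-chains, `(g, h) ↦ g + h - gh`, with coefficients in an
additive group. -/
noncomputable def boundary (G R : Type*) [Group G] [AddCommGroup R] :
    (G × G →₀ R) →+ (G →₀ R) :=
  Finsupp.liftAddHom fun p => Finsupp.singleAddHom p.1 + Finsupp.singleAddHom p.2 -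
    Finsupp.singleAddHom (p.1 * p.2)

lemma boundary_single {R : Type*} [AddCommGroup R] (p : G × G) (x : R) :
    boundary G R (Finsupp.single p x) =
      Finsupp.single p.1 x + Finsupp.single p.2 x - Finsupp.single (p.1 * p.2) x := by
  simp [boundary]

lemma mapRange_boundary {R S : Type*} [AddCommGroup R] [AddCommGroup S] (L : R →+ S)
    (r : G × G →₀ R) : (boundary G R r).mapRange L L.map_zero =
      boundary G S (r.mapRange L L.map_zero) := by
  have h : (Finsupp.mapRange.addMonoidHom L).comp (boundary G R) =
      (boundary G S).comp (Finsupp.mapRange.addMonoidHom L) := by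
    refine Finsupp.addHom_ext fun p x => ?_
    simp [boundary_single, Finsupp.mapRange.addMonoidHom, Finsupp.mapRange_add',
      Finsupp.mapRange_sub']
  exact DFunLike.congr_fun h r

/-- The growth of commutator length that results from filling `a` with `K` 2-simplices: up to an
additive constant, the `n`-th powers of the elements that represent `a` multiply to a product of
`K * n / 2` commutators, for even `n`. -/
def HasFilling (K : ℕ) (a : G →₀ ℤ) : Prop :=
  ∃ C : ℕ, ∀ m : ℕ, IsCommutatorMultiset (K * m + C)
    ((integralToMultiset a).map fun x => x ^ (2 * m))

namespace HasFilling

lemma zero : HasFilling 0 (0 : G →₀ ℤ) :=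
  ⟨0, fun m => ⟨[], by simp [integralToMultiset], by simpa using IsProdOfCommutators.one (G := G) 0⟩⟩

/-- Adding the boundary `ε₁ x + ε₂ y + ε₃ z` of a 2-simplex or of its negative. The constant grows by
`6`, since each of the three elements may cancel. -/
lemma single_add_single_add_single_add {K : ℕ} {a : G →₀ ℤ} (ha : HasFilling K a) {x y z : G}
    {ε₁ ε₂ ε₃ : ℤ} (h₁ : ε₁ = 1 ∨ ε₁ = -1) (h₂ : ε₂ = 1 ∨ ε₂ = -1) (h₃ : ε₃ = 1 ∨ ε₃ = -1)
    (hxyz : x ^ ε₁ * y ^ ε₂ = (z ^ ε₃)⁻¹) :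
    HasFilling (K + 1) (Finsupp.single x ε₁ + (Finsupp.single y ε₂ + (Finsupp.single z ε₃ + a))) := by
  obtain ⟨C, hC⟩ := ha
  refine ⟨C + 6, fun m => ?_⟩
  have htri : IsCommutatorMultiset m
      (({x ^ ε₁, y ^ ε₂, z ^ ε₃} : Multiset G).map fun u => u ^ (2 * m)) := by
    refine ⟨[x ^ ε₁, y ^ ε₂, z ^ ε₃].map fun u => u ^ (2 * m), rfl, ?_⟩
    have h := IsProdOfCommutators.pow_mul_pow_mul_pow_inv (x ^ ε₁) (y ^ ε₂) m
    rw [hxyz, inv_inv] at h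
    simpa [mul_assoc] using h
  have h0 : IsCommutatorMultiset (m + (K * m + C)) (((z ^ ε₃) ::ₘ (integralToMultiset a +
      {y ^ ε₂, x ^ ε₁})).map fun u => u ^ (2 * m)) := by
    convert htri.add (hC m) using 1
    rw [← Multiset.map_add]
    congr 1
    simp only [Multiset.insert_eq_cons, ← Multiset.singleton_add]
    abel
  have h1 := h0.integralToMultiset_single_add h₃
  have h2 : IsCommutatorMultiset (m + (K * m + C) + 2) (((y ^ ε₂) ::ₘ (integralToMultiset
      (Finsupp.single z ε₃ + a) + {x ^ ε₁})).map fun u => u ^ (2 * m)) := by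
    convert h1 using 2
    simp only [Multiset.insert_eq_cons, ← Multiset.singleton_add]
    abel
  have h3 := h2.integralToMultiset_single_add h₂
  have h4 : IsCommutatorMultiset (m + (K * m + C) + 2 + 2) (((x ^ ε₁) ::ₘ (integralToMultiset
      (Finsupp.single y ε₂ + (Finsupp.single z ε₃ + a)) + 0)).map fun u => u ^ (2 * m)) := by
    convert h3 using 2
    simp only [← Multiset.singleton_add]
    abel
  have h5 := h4.integralToMultiset_single_add h₁
  rw [add_zero] at h5
  convert h5 using 1
  ring

lemma boundary_single_add {K : ℕ} {a : G →₀ ℤ} (ha : HasFilling K a) (p : G × G) (k : ℤ) :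
    HasFilling (k.natAbs + K) (boundary G ℤ (Finsupp.single p k) + a) := by
  have hpos : ∀ i : ℕ, HasFilling (i + K) (boundary G ℤ (Finsupp.single p (i : ℤ)) + a) := by
    intro i
    induction i with
    | zero => simpa using ha
    | succ i ih =>
      convert ih.single_add_single_add_single_add (x := p.1) (y := p.2) (z := p.1 * p.2)
        (ε₁ := 1) (ε₂ := 1) (ε₃ := -1) (by simp) (by simp) (by simp) (by simp) using 1
      · ring
      · simp only [Nat.cast_succ, Finsupp.single_add, map_add, boundary_single, Finsupp.single_neg]
        abel
  have hneg : ∀ i : ℕ, HasFilling (i + K) (boundary G ℤ (Finsupp.single p (-(i : ℤ))) + a) := by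
    intro i
    induction i with
    | zero => simpa using ha
    | succ i ih =>
      -- The negative of the simplex `(g, h)` has the same boundary as `(h⁻¹, g⁻¹)`, with each `x⁻¹`
      -- in place of `-x`.
      convert ih.single_add_single_add_single_add (x := p.2) (y := p.1) (z := p.1 * p.2)
        (ε₁ := -1) (ε₂ := -1) (ε₃ := 1) (by simp) (by simp) (by simp) (by simp) using 1
      · ring
      · simp only [Nat.cast_succ, neg_add, Finsupp.single_add, Finsupp.single_neg, map_add, map_neg,
          boundary_single]
        abel
  obtain ⟨i, rfl | rfl⟩ := k.eq_nat_or_neg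
  · simpa using hpos i
  · simpa using hneg i

lemma of_boundary (n : G × G →₀ ℤ) :
    HasFilling (n.sum fun _ k => k.natAbs) (boundary G ℤ n) := by
  induction n using Finsupp.induction with
  | zero => simpa using zero (G := G)
  | single_add p k n hp _ ih =>
    rw [map_add, Finsupp.sum_add_index_of_disjoint, Finsupp.sum_single_index (by simp)]
    · exact ih.boundary_single_add p k
    · exact Finset.disjoint_of_subset_left Finsupp.support_single_subset (by simpa using hp)

lemma sclMultiset_le {K : ℕ} {a : G →₀ ℤ} (ha : HasFilling K a) :
    sclMultiset (integralToMultiset a) ≤ ENNReal.ofReal (K / 2) := by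
  obtain ⟨C, hC⟩ := ha
  have hlim : Tendsto (fun m : ℕ => ENNReal.ofReal (K / 2 + (C / 2 : ℝ) / m)) atTop
      (𝓝 (ENNReal.ofReal (K / 2 + 0))) :=
    ENNReal.tendsto_ofReal ((tendsto_const_div_atTop_nhds_zero_nat _).const_add _)
  rw [add_zero] at hlim
  have heven : Tendsto (fun m : ℕ => 2 * m) atTop atTop :=
    tendsto_id.const_mul_atTop' two_pos
  -- A lower limit is at most the lower limit along the even integers.
  refine ((liminf_le_liminf_of_le heven).trans ?_).trans hlim.liminf_eq.le
  rw [← liminf_comp]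
  refine liminf_le_liminf ?_
  filter_upwards [eventually_gt_atTop 0] with m hm
  have hm' : (0 : ℝ) < m := by exact_mod_cast hm
  have hcl := (hC m).cl_le
  have hcl' : ((cl ((integralToMultiset a).map fun x => x ^ (2 * m)) : ℕ∞) : ℝ≥0∞) ≤
      ENNReal.ofReal (K * m + C) := by
    refine (ENat.toENNReal_le.mpr hcl).trans_eq ?_
    rw [ENat.toENNReal_coe, ← ENNReal.ofReal_natCast]
    push_cast
    rfl
  simp only [Function.comp_apply]
  refine (ENNReal.div_le_div_right hcl' _).trans_eq ?_
  rw [← ENNReal.ofReal_natCast, ← ENNReal.ofReal_div_of_pos (by positivity)]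
  congr 1
  push_cast
  field_simp

end HasFilling

end IntegralChains

/-! ### The upper bound for rational and real boundaries -/

section RealChains

variable {G : Type*} [Group G]

lemma sclRat_boundary_le (r : G × G →₀ ℚ) :
    sclRat (boundary G ℚ r) ≤ ENNReal.ofReal ((r.sum fun _ x => |(x : ℝ)|) / 2) := by
  -- `N` is a common denominator and `n = N r`.
  set N : ℕ := ∏ p ∈ r.support, (r p).den with hN
  have hN0 : 0 < N := Finset.prod_pos fun p _ => (r p).den_pos
  have hN0' : (0 : ℝ) < N := by exact_mod_cast hN0
  have hint : ∀ p, ((N * r p).num : ℚ) = N * r p := by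
    intro p
    rw [← Rat.den_eq_one_iff]
    by_cases hp : p ∈ r.support
    · obtain ⟨k, hk⟩ := Finset.dvd_prod_of_mem (fun p => (r p).den) hp
      have h1 : (N : ℚ) * r p = ((k * (r p).num : ℤ) : ℚ) := by
        rw [hN, hk]
        push_cast
        rw [mul_right_comm, Rat.den_mul_eq_num, mul_comm]
      rw [h1]
      exact Rat.den_intCast _
    · simp [Finsupp.notMem_support_iff.mp hp]
  set n : G × G →₀ ℤ := r.mapRange (fun x => ((N : ℚ) * x).num) (by simp) with hn
  have hnr : n.mapRange (Int.castAddHom ℚ) (map_zero _) =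
      r.mapRange (AddMonoidHom.mulLeft (N : ℚ)) (map_zero _) := by
    ext p
    simpa [hn] using hint p
  have hsum : ((n.sum fun _ k => k.natAbs : ℕ) : ℝ) = N * r.sum fun _ x => |(x : ℝ)| := by
    rw [hn, Finsupp.sum_mapRange_index (by simp), Finsupp.sum, Finsupp.sum, Nat.cast_sum,
      Finset.mul_sum]
    refine Finset.sum_congr rfl fun p _ => ?_
    rw [Nat.cast_natAbs, Int.cast_abs, ← Rat.cast_intCast, hint p]
    push_cast
    rw [abs_mul, Nat.abs_cast]
  have hle : sclRat (boundary G ℚ r) ≤ sclMultiset (integralToMultiset (boundary G ℤ n)) / N := by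
    refine iInf_le_of_le N (iInf₂_le_of_le (boundary G ℤ n) ⟨hN0, fun g => ?_⟩ le_rfl)
    have h1 := congrArg (boundary G ℚ) hnr
    rw [← mapRange_boundary, ← mapRange_boundary] at h1
    simpa using DFunLike.congr_fun h1 g
  refine hle.trans ((ENNReal.div_le_div_right (HasFilling.of_boundary n).sclMultiset_le _).trans_eq
    ?_)
  rw [← ENNReal.ofReal_natCast N, ← ENNReal.ofReal_div_of_pos hN0', hsum]
  congr 1
  field_simp

/-- The identity of `ℝ` is a pointwise limit of `ℚ`-linear maps to `ℚ`: approximate the elements of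
a `ℚ`-basis. Applied to the coefficients of a real chain, such maps produce rational chains that
satisfy all rational linear relations which hold for the real chain. -/
lemma exists_seq_ratLinearMap_tendsto : ∃ L : ℕ → ℝ →ₗ[ℚ] ℚ,
    ∀ x : ℝ, Tendsto (fun n => (L n x : ℝ)) atTop (𝓝 x) := by
  have happ : ∀ x : ℝ, ∃ u : ℕ → ℚ, Tendsto (fun n => (u n : ℝ)) atTop (𝓝 x) := by
    intro x
    obtain ⟨v, hv, hlim⟩ := mem_closure_iff_seq_limit.mp (Rat.denseRange_cast (𝕜 := ℝ) x)
    choose u hu using hv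
    exact ⟨u, by simpa [hu] using hlim⟩
  choose u hu using happ
  let b := Module.Basis.ofVectorSpace ℚ ℝ
  refine ⟨fun n => b.constr ℚ fun i => u (b i) n, fun x => ?_⟩
  have h1 : ∀ n, ((b.constr ℚ (fun i => u (b i) n) x : ℚ) : ℝ) =
      ∑ i ∈ (b.repr x).support, (b.repr x i : ℝ) * (u (b i) n : ℝ) := by
    intro n
    rw [Module.Basis.constr_apply, Finsupp.sum]
    push_cast
    simp
  have h2 : x = ∑ i ∈ (b.repr x).support, (b.repr x i : ℝ) * b i := by
    conv_lhs => rw [← b.linearCombination_repr x, Finsupp.linearCombination_apply, Finsupp.sum]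
    simp [Rat.smul_def]
  simp only [h1]
  conv => arg 3; rw [h2]
  exact tendsto_finsetSum _ fun i _ => (hu (b i)).const_mul _

lemma boundary_mem_B₁ (r : G × G →₀ ℝ) : boundary G ℝ r ∈ B₁ G := by
  induction r using Finsupp.induction_linear with
  | zero => simp
  | add r s hr hs => simpa using add_mem hr hs
  | single p x =>
    have h : boundary G ℝ (Finsupp.single p x) =
        x • (Finsupp.single p.1 (1 : ℝ) + Finsupp.single p.2 1 -
          Finsupp.single (p.1 * p.2) 1) := by
      simp [boundary_single, smul_sub]
    rw [h]
    exact Submodule.smul_mem _ _ (Submodule.subset_span ⟨p, rfl⟩)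

lemma scl_boundary_le (r : G × G →₀ ℝ) :
    scl (boundary G ℝ r) ≤ ENNReal.ofReal ((r.sum fun _ x => |x|) / 2) := by
  obtain ⟨L, hL⟩ := exists_seq_ratLinearMap_tendsto
  set c := boundary G ℝ r with hc
  let ρ : ℕ → (G × G →₀ ℚ) := fun n => r.mapRange (L n).toAddMonoidHom (map_zero _)
  have hρ : ∀ n, boundary G ℚ (ρ n) = c.mapRange (L n).toAddMonoidHom (map_zero _) :=
    fun n => (mapRange_boundary _ r).symm
  have hlim : Tendsto (fun n => boundary G ℚ (ρ n)) atTop (ratApprox c) := by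
    refine tendsto_inf.mpr ⟨tendsto_comap_iff.mpr (tendsto_pi_nhds.mpr fun g => ?_),
      tendsto_principal.mpr (Eventually.of_forall fun n => ⟨?_, ?_⟩)⟩
    · simpa [hρ] using hL (c g)
    · rw [hρ]
      exact Finsupp.support_mapRange
    · have h1 := mapRange_boundary (Rat.castHom ℝ).toAddMonoidHom (ρ n)
      change (boundary G ℚ (ρ n)).mapRange (Rat.castHom ℝ).toAddMonoidHom (map_zero _) ∈ B₁ G
      rw [h1]
      exact boundary_mem_B₁ _
  have hbound : Tendsto (fun n => ENNReal.ofReal (((ρ n).sum fun _ x => |(x : ℝ)|) / 2)) atTop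
      (𝓝 (ENNReal.ofReal ((r.sum fun _ x => |x|) / 2))) := by
    refine ENNReal.tendsto_ofReal (Tendsto.div_const ?_ 2)
    have h1 : ∀ n, ((ρ n).sum fun _ x => |(x : ℝ)|) = ∑ p ∈ r.support, |(L n (r p) : ℝ)| := by
      intro n
      rw [Finsupp.sum_mapRange_index (by simp)]
      rfl
    simp only [h1]
    exact tendsto_finsetSum _ fun p _ => (hL (r p)).abs
  rw [scl, if_pos (boundary_mem_B₁ r)]
  refine (liminf_le_liminf_of_le hlim).trans ?_
  rw [← hbound.liminf_eq, ← liminf_comp]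
  exact liminf_le_liminf (Eventually.of_forall fun n => sclRat_boundary_le (ρ n))

/-- The class in `C₁ᴴ(G)` of the boundary of a real 2-chain. -/
noncomputable def boundaryH (G : Type*) [Group G] : (G × G →₀ ℝ) →ₗ[ℝ] C₁H G :=
  (homogRel G).mkQ ∘ₗ Finsupp.linearCombination ℝ fun p : G × G =>
    Finsupp.single p.1 (1 : ℝ) + Finsupp.single p.2 1 - Finsupp.single (p.1 * p.2) 1

lemma boundaryH_apply (r : G × G →₀ ℝ) : boundaryH G r = (homogRel G).mkQ (boundary G ℝ r) := by
  rw [boundaryH, LinearMap.comp_apply]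
  congr 1
  induction r using Finsupp.induction_linear with
  | zero => simp
  | add r s hr hs => simp [hr, hs]
  | single p x => simp [boundary_single, smul_sub]

/-- `scl` is at most half of the `ℓ¹`-norm of a filling. -/
lemma sclH_boundaryH_le (r : G × G →₀ ℝ) :
    sclH (boundaryH G r) ≤ ENNReal.ofReal ((r.sum fun _ x => |x|) / 2) :=
  (iInf₂_le (boundary G ℝ r) (boundaryH_apply r).symm).trans (scl_boundary_le r)

end RealChains

/-! ### Extension of quasimorphisms -/

section Extension

lemma exists_comp_eq_of_ker_le {K A B C : Type*} [Field K] [AddCommGroup A] [AddCommGroup B]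
    [AddCommGroup C] [Module K A] [Module K B] [Module K C] (g : A →ₗ[K] B) (l : A →ₗ[K] C)
    (h : LinearMap.ker g ≤ LinearMap.ker l) : ∃ d : B →ₗ[K] C, d ∘ₗ g = l := by
  obtain ⟨d, hd⟩ := LinearMap.exists_extend
    ((LinearMap.ker g).liftQ l h ∘ₗ g.quotKerEquivRange.symm.toLinearMap)
  refine ⟨d, LinearMap.ext fun x => ?_⟩
  have h1 := LinearMap.congr_fun hd (g.rangeRestrict x)
  have h2 : g.quotKerEquivRange.symm (g.rangeRestrict x) = (LinearMap.ker g).mkQ x := by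
    rw [LinearEquiv.symm_apply_eq]
    rfl
  rw [LinearMap.comp_apply, LinearMap.comp_apply, LinearEquiv.coe_coe, h2] at h1
  simpa using h1

/-- Hahn–Banach with respect to the `ℓ¹`-norm, scaled by `d`. -/
lemma exists_extension_of_le_sum_abs {ι : Type*} {d : ℝ} (hd : 0 ≤ d) (p : Submodule ℝ (ι →₀ ℝ))
    (l : (ι →₀ ℝ) →ₗ[ℝ] ℝ) (hl : ∀ r ∈ p, |l r| ≤ d * r.sum fun _ x => |x|) :
    ∃ l' : (ι →₀ ℝ) →ₗ[ℝ] ℝ, (∀ r ∈ p, l' r = l r) ∧ ∀ i, |l' (Finsupp.single i 1)| ≤ d := by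
  have hsmul : ∀ c : ℝ, 0 < c → ∀ r : ι →₀ ℝ,
      d * ((c • r).sum fun _ x => |x|) = c * (d * r.sum fun _ x => |x|) := by
    intro c hc r
    rw [Finsupp.sum_smul_index' (by simp), Finsupp.sum, Finsupp.sum]
    simp only [smul_eq_mul, abs_mul, abs_of_pos hc, ← Finset.mul_sum]
    ring
  have hadd : ∀ r s : ι →₀ ℝ, d * ((r + s).sum fun _ x => |x|) ≤
      d * (r.sum fun _ x => |x|) + d * s.sum fun _ x => |x| := by
    intro r s
    classical
    rw [← mul_add]
    refine mul_le_mul_of_nonneg_left ?_ hd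
    rw [Finsupp.sum_of_support_subset _ Finsupp.support_add _ (by simp),
      Finsupp.sum_of_support_subset r Finset.subset_union_left _ (by simp),
      Finsupp.sum_of_support_subset s Finset.subset_union_right _ (by simp),
      ← Finset.sum_add_distrib]
    exact Finset.sum_le_sum fun i _ => abs_add_le _ _
  obtain ⟨l', h1, h2⟩ := exists_extension_of_le_sublinear ⟨p, l ∘ₗ p.subtype⟩
    (fun r => d * r.sum fun _ x => |x|) hsmul hadd fun r => (le_abs_self _).trans (hl r r.2)
  refine ⟨l', fun r hr => h1 ⟨r, hr⟩, fun i => abs_le.mpr ⟨?_, ?_⟩⟩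
  · have h3 := h2 (Finsupp.single i (-1))
    rw [Finsupp.sum_single_index (by simp), Finsupp.single_neg, map_neg] at h3
    simp only [abs_neg, abs_one, mul_one] at h3
    linarith
  · simpa using h2 (Finsupp.single i 1)

variable {G : Type*} [Group G]

/-- A linear functional on homogeneous chains that is bounded on the boundaries of 2-simplices is a
homogeneous quasimorphism. -/
lemma mem_homogQM_and_defect_le {Λ : C₁H G →ₗ[ℝ] ℝ} {d : ℝ}
    (hΛ : ∀ p : G × G, |Λ (boundaryH G (Finsupp.single p 1))| ≤ d) :
    (fun g => Λ ((homogRel G).mkQ (Finsupp.single g 1))) ∈ homogQM G ∧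
      defect (fun g => Λ ((homogRel G).mkQ (Finsupp.single g 1))) ≤ d := by
  have h : ∀ p : G × G, |Λ ((homogRel G).mkQ (Finsupp.single p.1 1)) +
      Λ ((homogRel G).mkQ (Finsupp.single p.2 1)) -
      Λ ((homogRel G).mkQ (Finsupp.single (p.1 * p.2) 1))| ≤ d := by
    intro p
    simpa only [boundaryH_apply, boundary_single, map_add, map_sub] using hΛ p
  refine ⟨⟨⟨d, ?_⟩, fun g n => ?_⟩, ciSup_le h⟩
  · rintro _ ⟨p, rfl⟩
    exact h p
  · have h1 : (homogRel G).mkQ (Finsupp.single (g ^ n) (1 : ℝ)) =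
        (n : ℝ) • (homogRel G).mkQ (Finsupp.single g 1) := by
      rw [← map_smul, ← sub_eq_zero, ← map_sub, ← LinearMap.mem_ker, Submodule.ker_mkQ]
      exact Submodule.subset_span (Or.inl ⟨g, n, rfl⟩)
    simp only [h1, map_smul, smul_eq_mul]

lemma evalC₁H_mkQ_single {φ : G → ℝ} (hφ : φ ∈ homogQM G) (g : G) :
    evalC₁H hφ ((homogRel G).mkQ (Finsupp.single g 1)) = φ g := by
  simp [evalC₁H]

variable {G₁ G₂ : Type*} [Group G₁] [Group G₂]

lemma defect_le_of_comp_eq {f : G₁ →* G₂} {φ₁ : G₁ → ℝ} {φ₂ : G₂ → ℝ} (hφ₂ : φ₂ ∈ homogQM G₂)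
    (h : ∀ g, φ₂ (f g) = φ₁ g) : defect φ₁ ≤ defect φ₂ :=
  ciSup_le fun p => by
    simpa [h, ← map_mul] using abs_add_sub_mul_le_defect hφ₂ (f p.1) (f p.2)

/-- Extension of homogeneous quasimorphisms along an isometric homomorphism, without increase of the
defect. -/
theorem exists_extension_of_isIsometric {f : G₁ →* G₂} (hf : IsIsometric f) {φ₁ : G₁ → ℝ}
    (hφ₁ : φ₁ ∈ homogQM G₁) :
    ∃ φ₂ ∈ homogQM G₂, defect φ₂ = defect φ₁ ∧ ∀ g : G₁, φ₂ (f g) = φ₁ g := by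
  -- The value `scl = ∞` outside of the boundaries matters here: `x` is not assumed to be a boundary,
  -- only its image is.
  have hbound : ∀ (x : C₁H G₁) (r : G₂ × G₂ →₀ ℝ), C₁H.map f x = boundaryH G₂ r →
      |evalC₁H hφ₁ x| ≤ defect φ₁ * r.sum fun _ x => |x| := by
    intro x r hx
    have hS : (0 : ℝ) ≤ r.sum fun _ x => |x| := Finset.sum_nonneg fun _ _ => abs_nonneg _
    have h1 : sclH x ≤ ENNReal.ofReal ((r.sum fun _ x => |x|) / 2) := by
      rw [← hf x, hx]
      exact sclH_boundaryH_le r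
    have hlim : Tendsto (fun ε : ℝ => 2 * defect φ₁ * ((r.sum fun _ x => |x|) / 2 + ε)) (𝓝[>] 0)
        (𝓝 (2 * defect φ₁ * ((r.sum fun _ x => |x|) / 2 + 0))) :=
      ((tendsto_id.mono_left nhdsWithin_le_nhds).const_add _).const_mul _
    have h2 : |evalC₁H hφ₁ x| ≤ 2 * defect φ₁ * ((r.sum fun _ x => |x|) / 2 + 0) := by
      refine ge_of_tendsto hlim ?_
      filter_upwards [self_mem_nhdsWithin] with ε hε
      have hε' : (0 : ℝ) < ε := hε
      exact abs_evalC₁H_le_of_sclH_lt hφ₁ (h1.trans_lt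
        ((ENNReal.ofReal_lt_ofReal_iff (by linarith)).mpr (by linarith)))
    linarith
  -- `φ₁` vanishes on the kernel of the induced map, so it factors through some functional `ψ`.
  obtain ⟨ψ, hψ⟩ := exists_comp_eq_of_ker_le (C₁H.map f) (evalC₁H hφ₁) fun x hx => by
    have h1 := hbound x 0 (by rw [map_zero]; exact hx)
    simpa using h1
  have hψ' : ∀ x, ψ (C₁H.map f x) = evalC₁H hφ₁ x := LinearMap.congr_fun hψ
  let W : Submodule ℝ (C₁H G₂) := LinearMap.range (C₁H.map f)
  obtain ⟨l, hl, hld⟩ := exists_extension_of_le_sum_abs (defect_nonneg φ₁) (W.comap (boundaryH G₂))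
    (ψ ∘ₗ boundaryH G₂) (by
      rintro r ⟨x, hx⟩
      rw [LinearMap.comp_apply, ← hx, hψ']
      exact hbound x r hx)
  -- `l` and `ψ` agree where both are determined; correcting `ψ` by a functional that vanishes on
  -- `W` makes it restrict to `l` on all boundaries.
  obtain ⟨δ, hδ⟩ := exists_comp_eq_of_ker_le (W.mkQ ∘ₗ boundaryH G₂) (l - ψ ∘ₗ boundaryH G₂)
    fun r hr => by
      have hr' : r ∈ W.comap (boundaryH G₂) := by
        simpa using hr
      rw [LinearMap.mem_ker, LinearMap.sub_apply, hl r hr', sub_self]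
  have hΛ : ∀ r, (ψ + δ ∘ₗ W.mkQ) (boundaryH G₂ r) = l r := by
    intro r
    have h1 := LinearMap.congr_fun hδ r
    simp only [LinearMap.comp_apply, LinearMap.sub_apply] at h1
    simp only [LinearMap.add_apply, LinearMap.comp_apply, h1, add_sub_cancel]
  obtain ⟨hmem, hdef⟩ := mem_homogQM_and_defect_le (Λ := ψ + δ ∘ₗ W.mkQ) (d := defect φ₁)
    fun p => by rw [hΛ]; exact hld p
  have hext : ∀ g : G₁,
      (ψ + δ ∘ₗ W.mkQ) ((homogRel G₂).mkQ (Finsupp.single (f g) 1)) = φ₁ g := by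
    intro g
    have h1 : (homogRel G₂).mkQ (Finsupp.single (f g) (1 : ℝ)) =
        C₁H.map f ((homogRel G₁).mkQ (Finsupp.single g 1)) := by
      simp [C₁H.map]
    have h2 : W.mkQ (C₁H.map f ((homogRel G₁).mkQ (Finsupp.single g 1))) = 0 := by
      rw [← LinearMap.mem_ker, Submodule.ker_mkQ]
      exact LinearMap.mem_range_self _ _
    rw [h1, LinearMap.add_apply, LinearMap.comp_apply, h2, map_zero, add_zero, hψ',
      evalC₁H_mkQ_single]
  exact ⟨_, hmem, le_antisymm hdef (defect_le_of_comp_eq hmem hext), hext⟩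

end Extension

end Scl

theorem mainTheorem9 {G₁ G₂ : Type*} [Group G₁] [Group G₂] (f : G₁ →* G₂)
    (hf : Scl.IsIsometric f) :
    (∀ φ₁ ∈ Scl.homogQM G₁, ∃ φ₂ ∈ Scl.homogQM G₂,
      Scl.defect φ₂ = Scl.defect φ₁ ∧ ∀ g : G₁, φ₂ (f g) = φ₁ g) ∧
    Function.Surjective (Scl.quotientPullback f) := by
  refine ⟨fun φ₁ hφ₁ => Scl.exists_extension_of_isIsometric hf hφ₁, fun x => ?_⟩
  obtain ⟨⟨φ₁, hφ₁⟩, rfl⟩ := Submodule.mkQ_surjective _ x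
  obtain ⟨φ₂, hφ₂, -, h⟩ := Scl.exists_extension_of_isIsometric hf hφ₁
  refine ⟨(Scl.homs G₂).mkQ ⟨φ₂, hφ₂⟩, ?_⟩
  have hpull : Scl.pullback f ⟨φ₂, hφ₂⟩ = ⟨φ₁, hφ₁⟩ := Subtype.ext (funext h)
  exact congrArg (Scl.homs G₁).mkQ hpull
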